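/- Let $\lambda=(\lambda_n)_{n\ge 1}$ be a frequency, i.e. a strictly increasing sequence of non-negative real numbers tending to $+\infty$, and write $[\mathrm{Re}>\sigma]=\{s\in\mathbb{C}:\mathrm{Re}\, s>\sigma\}$. Let $\mathcal{D}_\infty^{ext}(\lambda)$ denote the space of all formal Dirichlet series $D=\sum_n a_n e^{-\lambda_n s}$ with complex coefficients which converge at some point of $\mathbb{C}$ and whose limit function admits a bounded holomorphic extension $f$ to $[\mathrm{Re}>0]$; put $\|D\|_\infty:=\sup_{[\mathrm{Re}>0]}|f(s)|$, where $f$ is this (unique) extension. Assume that $\lambda$ satisfies Landau's condition $$(LC)\qquad \forall\,\delta>0\ \exists\, C>0\ \forall\, n\in\mathbb{N}:\quad \lambda_{n+1}-\lambda_n\ge C e^{-e^{\delta\lambda_n}}.$$ Then for every $\delta>0$ there is a constant $C=C(\delta,\lambda)>0$ such that for all $D=\sum a_n e^{-\lambda_n s}\in\mathcal{D}_\infty^{ext}(\lambda)$ and all $N\in\mathbb{N}$, $N\ge 1$, $$\sup_{[\mathrm{Re}>0]}\Big|\sum_{n=1}^N a_n e^{-\lambda_n s}\Big|\le C e^{\delta\lambda_N}\|D\|_\infty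 .$$ In particular, $\lambda$ satisfies Bohr's theorem: every $D\in\mathcal{D}_\infty^{ext}(\lambda)$ converges uniformly on $[\mathrm{Re}>\varepsilon]$ for every $\varepsilon>0$. -/

import Mathlib

namespace GenDirichlet

/-- A frequency: a strictly increasing sequence of non-negative reals tending to `+∞`.
Sequences are indexed from `0`, so `lam n` is the `(n+1)`-st frequency. -/
structure IsFrequency (lam : ℕ → ℝ) : Prop where
  strictMono : StrictMono lam
  nonneg : ∀ n, 0 ≤ lam n
  tendsto_atTop : Filter.Tendsto lam Filter.atTop Filter.atTop

/-- Landau's condition (LC). -/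
def LandauCondition (lam : ℕ → ℝ) : Prop :=
  ∀ δ : ℝ, 0 < δ → ∃ C : ℝ, 0 < C ∧
    ∀ n : ℕ, C * Real.exp (-Real.exp (δ * lam n)) ≤ lam (n + 1) - lam n

/-- The open half plane `[Re > σ]`. -/
def halfPlane (σ : ℝ) : Set ℂ := {s : ℂ | σ < s.re}

/-- The sum of the first `N` terms of the Dirichlet series with coefficients `a`, at `s`. -/
noncomputable def partialSum (lam : ℕ → ℝ) (a : ℕ → ℂ) (N : ℕ) (s : ℂ) : ℂ :=
  ∑ n ∈ Finset.range N, a n * Complex.exp (-(lam n : ℂ) * s)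

/-- The Dirichlet series converges (possibly conditionally) at the point `s`. -/
def ConvergesAt (lam : ℕ → ℝ) (a : ℕ → ℂ) (s : ℂ) : Prop :=
  ∃ l : ℂ, Filter.Tendsto (fun N => partialSum lam a N s) Filter.atTop (nhds l)

/-- The abscissa of convergence: the infimum, in the extended reals, of all real `σ` such that
the series converges on `[Re > σ]`. -/
noncomputable def abscissaConv (lam : ℕ → ℝ) (a : ℕ → ℂ) : EReal :=
  sInf ((fun σ : ℝ => (σ : EReal)) '' {σ : ℝ | ∀ s ∈ halfPlane σ, ConvergesAt lam a s})

/-- `f` is a bounded holomorphic function on `[Re > 0]` that extends the limit function of the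
Dirichlet series: it is the sum of the series at each point of `[Re > 0]` that lies in the open
half plane of convergence. -/
structure IsBoundedExtension (lam : ℕ → ℝ) (a : ℕ → ℂ) (f : ℂ → ℂ) : Prop where
  holomorphic : DifferentiableOn ℂ f (halfPlane 0)
  bounded : ∃ M : ℝ, ∀ s ∈ halfPlane 0, ‖f s‖ ≤ M
  extends_series : ∀ s ∈ halfPlane 0, abscissaConv lam a < (s.re : EReal) →
    Filter.Tendsto (fun N => partialSum lam a N s) Filter.atTop (nhds (f s))

/-- The coefficient sequences of the somewhere convergent Dirichlet series that have a bounded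
holomorphic extension to `[Re > 0]`. -/
def DInftyExt (lam : ℕ → ℝ) : Set (ℕ → ℂ) :=
  {a | (∃ s : ℂ, ConvergesAt lam a s) ∧ ∃ f : ℂ → ℂ, IsBoundedExtension lam a f}

/-- The supremum of `|g|` over `[Re > 0]`, as an extended non-negative real. If `f` is the
bounded extension of a series `D`, then `supRightHalfPlane f` is the norm `‖D‖_∞`. -/
noncomputable def supRightHalfPlane (g : ℂ → ℂ) : ENNReal :=
  ⨆ s ∈ halfPlane 0, ‖g s‖ₑ

/-- `lam` satisfies Bohr's theorem. -/
def SatisfiesBohr (lam : ℕ → ℝ) : Prop :=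
  ∀ a ∈ DInftyExt lam, ∀ ε : ℝ, 0 < ε →
    ∃ g : ℂ → ℂ, TendstoUniformlyOn (partialSum lam a) g Filter.atTop (halfPlane ε)

end GenDirichlet

/-! A partial sum is the series multiplied by a sharp cutoff in frequency. The gap between `λ_N` and
`λ_{N+1}` leaves room for a continuous cutoff, and such a cutoff is convolution of `f` along
vertical lines with an integrable kernel. The kernel `sin (c u) sin² (η u) / u³` has a Fourier
transform that is constant, `2 B η²`, on `|l| ≤ c - 2η` and zero for `|l| ≥ c + 2η`, while its `L¹`
norm is at most `η² (3 + 2 log (c / η))`. Dividing by `2 B η²` bounds the partial sum by a multiple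
of `(3 + 2 log (c / η)) ‖f‖_∞`. With `η` comparable to the gap (capped at 1) and `c` just above
`λ_N`, Landau's condition makes this logarithm `O(e^{δ λ_N})`.

The averaging identity `integral_sinKernel_mul_extension` is proved first where the series converges
and then carried to `[Re > 0]` by the identity theorem. Bohr's theorem follows by summation by
parts, since a shift by `2δ` beats growth of order `e^{δ λ_N}`. -/

open MeasureTheory Set Filter Topology

namespace GenDirichlet

/-! ### The building block of the kernel's Fourier transform -/

/-- The function `(u - sin u) / u ^ 3`, which generates the smoothing kernels below. -/
noncomputable def sinRemainder (u : ℝ) : ℝ := (u - Real.sin u) / u ^ 3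

lemma sinRemainder_neg (u : ℝ) : sinRemainder (-u) = sinRemainder u := by
  unfold sinRemainder
  rw [Real.sin_neg, Odd.neg_pow (by decide), show -u - -Real.sin u = -(u - Real.sin u) by ring,
    neg_div_neg_eq]

lemma sinRemainder_pos_of_pos {u : ℝ} (hu : 0 < u) : 0 < sinRemainder u :=
  div_pos (sub_pos.2 (Real.sin_lt hu)) (by positivity)

lemma sinRemainder_nonneg (u : ℝ) : 0 ≤ sinRemainder u := by
  rcases lt_trichotomy u 0 with h | h | h
  · rw [← sinRemainder_neg]
    exact (sinRemainder_pos_of_pos (neg_pos.2 h)).le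
  · simp [sinRemainder, h]
  · exact (sinRemainder_pos_of_pos h).le

lemma sinRemainder_le_of_pos {u : ℝ} (hu : 0 < u) : sinRemainder u ≤ 4 * (1 + u ^ 2)⁻¹ := by
  unfold sinRemainder
  rw [← div_eq_mul_inv, div_le_div_iff₀ (by positivity) (by positivity)]
  rcases le_total u 1 with h1 | h1
  · have h2 : u - Real.sin u ≤ u ^ 3 / 4 := by linarith [Real.sin_gt_sub_cube hu, pow_pos hu 3]
    have h3 : 1 + u ^ 2 ≤ 2 := by nlinarith
    calc (u - Real.sin u) * (1 + u ^ 2) ≤ u ^ 3 / 4 * 2 := by gcongr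
      _ ≤ 4 * u ^ 3 := by nlinarith [pow_pos hu 3]
  · have h2 : u - Real.sin u ≤ 2 * u := by linarith [Real.neg_one_le_sin u]
    have h3 : 1 + u ^ 2 ≤ 2 * u ^ 2 := by nlinarith
    calc (u - Real.sin u) * (1 + u ^ 2) ≤ 2 * u * (2 * u ^ 2) := by gcongr
      _ = 4 * u ^ 3 := by ring

lemma sinRemainder_le (u : ℝ) : sinRemainder u ≤ 4 * (1 + u ^ 2)⁻¹ := by
  rcases lt_trichotomy u 0 with h | h | h
  · rw [← sinRemainder_neg, ← neg_sq u]
    exact sinRemainder_le_of_pos (neg_pos.2 h)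
  · simp [sinRemainder, h]
  · exact sinRemainder_le_of_pos h

lemma integrable_sinRemainder : Integrable sinRemainder := by
  refine (integrable_inv_one_add_sq.const_mul 4).mono' ?_ (ae_of_all _ fun u => ?_)
  · unfold sinRemainder
    exact Measurable.aestronglyMeasurable (by fun_prop)
  · rw [Real.norm_of_nonneg (sinRemainder_nonneg u)]
    exact sinRemainder_le u

/-- The integral of `(u - sin u) / u ^ 3` over the real line. -/
noncomputable def sinRemainderIntegral : ℝ := ∫ u, sinRemainder u

lemma sinRemainderIntegral_pos : 0 < sinRemainderIntegral := by
  refine (integral_pos_iff_support_of_nonneg sinRemainder_nonneg integrable_sinRemainder).2 ?_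
  refine lt_of_lt_of_le ?_ (measure_mono (s := Ioi (0 : ℝ)) fun u hu =>
    (sinRemainder_pos_of_pos hu).ne')
  simp

lemma scaled_sinRemainder_eq (x u : ℝ) :
    (x * u - Real.sin (x * u)) / u ^ 3 = x ^ 3 * sinRemainder (x * u) := by
  unfold sinRemainder
  rcases eq_or_ne x 0 with rfl | hx
  · simp
  · rw [mul_pow, ← mul_div_assoc, mul_div_mul_left _ _ (pow_ne_zero 3 hx)]

lemma integrable_scaled_sinRemainder (x : ℝ) :
    Integrable fun u : ℝ => (x * u - Real.sin (x * u)) / u ^ 3 := by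
  simp_rw [scaled_sinRemainder_eq]
  rcases eq_or_ne x 0 with rfl | hx
  · simp
  · exact (integrable_sinRemainder.comp_mul_left' hx).const_mul _

/-- Homogeneity: `x³` from the cube and `1 / |x|` from the change of variables. The value of the
constant never matters, only its positivity. -/
lemma integral_scaled_sinRemainder (x : ℝ) :
    ∫ u : ℝ, (x * u - Real.sin (x * u)) / u ^ 3 = x * |x| * sinRemainderIntegral := by
  simp_rw [scaled_sinRemainder_eq]
  rw [integral_const_mul, Measure.integral_comp_mul_left]
  rcases eq_or_ne x 0 with rfl | hx
  · simp
  · have h : |x| ≠ 0 := abs_ne_zero.2 hx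
    rw [abs_inv, smul_eq_mul, ← sinRemainderIntegral, ← mul_assoc]
    congr 1
    field_simp
    rw [sq_abs]

/-! ### The kernel and its Fourier transform -/

/-- The kernel `sin (c u) sin² (η u) / u³`. -/
noncomputable def sinKernel (c η u : ℝ) : ℝ := Real.sin (c * u) * Real.sin (η * u) ^ 2 / u ^ 3

lemma sinKernel_neg (c η u : ℝ) : sinKernel c η (-u) = sinKernel c η u := by
  unfold sinKernel
  rw [mul_neg, mul_neg, Real.sin_neg, Real.sin_neg, neg_sq, neg_mul,
    Odd.neg_pow (n := 3) (by decide), neg_div_neg_eq]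

lemma measurable_sinKernel (c η : ℝ) : Measurable (sinKernel c η) := by
  unfold sinKernel
  fun_prop

/-- Product-to-sum formulas give six sines. The linear terms inserted here cancel, as both groups
add up to `2 c u`, and they make each summand integrable on its own. -/
lemma sinKernel_mul_cos (c η l u : ℝ) :
    sinKernel c η u * Real.cos (l * u) =
      1 / 4 * (1 / 2 * (((c + 2 * η + l) * u - Real.sin ((c + 2 * η + l) * u)) / u ^ 3
        + ((c + 2 * η - l) * u - Real.sin ((c + 2 * η - l) * u)) / u ^ 3
        + ((c - 2 * η + l) * u - Real.sin ((c - 2 * η + l) * u)) / u ^ 3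
        + ((c - 2 * η - l) * u - Real.sin ((c - 2 * η - l) * u)) / u ^ 3)
        - (((c + l) * u - Real.sin ((c + l) * u)) / u ^ 3
        + ((c - l) * u - Real.sin ((c - l) * u)) / u ^ 3)) := by
  have key : Real.sin (c * u) * Real.sin (η * u) ^ 2 * Real.cos (l * u) =
      1 / 4 * (1 / 2 * (((c + 2 * η + l) * u - Real.sin ((c + 2 * η + l) * u))
        + ((c + 2 * η - l) * u - Real.sin ((c + 2 * η - l) * u))
        + ((c - 2 * η + l) * u - Real.sin ((c - 2 * η + l) * u))
        + ((c - 2 * η - l) * u - Real.sin ((c - 2 * η - l) * u)))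
        - (((c + l) * u - Real.sin ((c + l) * u))
        + ((c - l) * u - Real.sin ((c - l) * u)))) := by
    simp only [add_mul, sub_mul, mul_assoc]
    simp only [Real.sin_add, Real.sin_sub, Real.cos_add, Real.cos_sub, Real.sin_two_mul,
      Real.cos_two_mul, Real.cos_sq' (η * u)]
    ring
  unfold sinKernel
  rw [div_mul_eq_mul_div, key]
  ring

lemma integrable_sinKernel_mul_cos (c η l : ℝ) :
    Integrable fun u => sinKernel c η u * Real.cos (l * u) := by
  simp_rw [sinKernel_mul_cos]
  have h := integrable_scaled_sinRemainder
  exact (((((h _).add (h _)).add (h _)).add (h _)).const_mul _ |>.sub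
    ((h _).add (h _))).const_mul _

lemma integrable_sinKernel (c η : ℝ) : Integrable (sinKernel c η) := by
  simpa using integrable_sinKernel_mul_cos c η 0

lemma integral_sinKernel_mul_cos (c η l : ℝ) :
    ∫ u, sinKernel c η u * Real.cos (l * u) = sinRemainderIntegral / 4 *
      (1 / 2 * ((c + 2 * η + l) * |c + 2 * η + l| + (c + 2 * η - l) * |c + 2 * η - l|
        + (c - 2 * η + l) * |c - 2 * η + l| + (c - 2 * η - l) * |c - 2 * η - l|)
        - ((c + l) * |c + l| + (c - l) * |c - l|)) := by
  have h := integrable_scaled_sinRemainder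
  simp_rw [sinKernel_mul_cos]
  rw [integral_const_mul, integral_sub, integral_const_mul, integral_add, integral_add,
    integral_add, integral_add]
  · simp only [integral_scaled_sinRemainder]
    ring
  all_goals first
    | exact h _
    | exact (h _).add (h _)
    | exact ((h _).add (h _)).add (h _)
    | exact (((h _).add (h _)).add (h _)).add (h _)
    | exact ((((h _).add (h _)).add (h _)).add (h _)).const_mul _

/-- All arguments are non-negative, so `x|x| = x²`, and the second differences with step `2η` at `c
+ l` and `c - l` contribute `4η²` each. -/
lemma integral_sinKernel_mul_cos_of_le {c η l : ℝ} (hη : 0 ≤ η) (hl : 0 ≤ l)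
    (h : l ≤ c - 2 * η) :
    ∫ u, sinKernel c η u * Real.cos (l * u) = 2 * sinRemainderIntegral * η ^ 2 := by
  rw [integral_sinKernel_mul_cos, abs_of_nonneg, abs_of_nonneg, abs_of_nonneg, abs_of_nonneg,
    abs_of_nonneg, abs_of_nonneg]
  · ring
  all_goals linarith

/-- The arguments around `c - l` are now non-positive, so the second difference there is `-4η²` and
cancels the one at `c + l`. -/
lemma integral_sinKernel_mul_cos_of_ge {c η l : ℝ} (hη : 0 ≤ η) (hc : 2 * η ≤ c)
    (h : c + 2 * η ≤ l) : ∫ u, sinKernel c η u * Real.cos (l * u) = 0 := by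
  rw [integral_sinKernel_mul_cos, abs_of_nonneg, abs_of_nonpos, abs_of_nonneg, abs_of_nonpos,
    abs_of_nonneg, abs_of_nonpos]
  · ring
  all_goals linarith

lemma integral_sinKernel_mul_cexp (c η l : ℝ) :
    ∫ u : ℝ, (sinKernel c η u : ℂ) * Complex.exp (-(l : ℂ) * (u * Complex.I)) =
      ((∫ u, sinKernel c η u * Real.cos (l * u) : ℝ) : ℂ) := by
  have hint : Integrable fun u : ℝ =>
      (sinKernel c η u : ℂ) * Complex.exp (-(l : ℂ) * (u * Complex.I)) := by
    refine (integrable_sinKernel c η).ofReal.mul_bdd (c := 1) ?_ (ae_of_all _ fun u => ?_)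
    · exact Continuous.aestronglyMeasurable (by fun_prop)
    · rw [Complex.norm_exp]
      simp
  have hneg := integral_neg_eq_self
    (fun u : ℝ => (sinKernel c η u : ℂ) * Complex.exp (-(l : ℂ) * (u * Complex.I))) volume
  have hsum := integral_add hint hint.comp_neg
  rw [hneg] at hsum
  have hcos : ∀ u : ℝ, (sinKernel c η u : ℂ) * Complex.exp (-(l : ℂ) * (u * Complex.I)) +
      (sinKernel c η (-u) : ℂ) * Complex.exp (-(l : ℂ) * ((-u : ℝ) * Complex.I)) =
      2 * ((sinKernel c η u * Real.cos (l * u) : ℝ) : ℂ) := by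
    intro u
    rw [sinKernel_neg, ← mul_add]
    push_cast
    rw [Complex.cos, show -(l : ℂ) * (u * Complex.I) = -(l * u) * Complex.I by ring,
      show -(l : ℂ) * (-u * Complex.I) = l * u * Complex.I by ring]
    ring
  simp_rw [hcos] at hsum
  rw [integral_const_mul, integral_complex_ofReal] at hsum
  linear_combination -(1 / 2 : ℂ) * hsum

/-! ### Size of the kernel -/

lemma abs_sinKernel_le_mul (c η : ℝ) {u : ℝ} (hc : 0 ≤ c) (hu : 0 < u) :
    |sinKernel c η u| ≤ η ^ 2 * c := by
  unfold sinKernel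
  rw [abs_div, abs_mul, abs_pow, abs_pow, abs_of_pos hu, div_le_iff₀ (by positivity)]
  have h1 : |Real.sin (c * u)| ≤ c * u := by
    simpa [abs_of_nonneg (mul_nonneg hc hu.le)] using Real.abs_sin_le_abs (x := c * u)
  have h2 : |Real.sin (η * u)| ^ 2 ≤ (η * u) ^ 2 := by
    rw [sq_abs]
    exact sq_le_sq.2 Real.abs_sin_le_abs
  calc |Real.sin (c * u)| * |Real.sin (η * u)| ^ 2 ≤ c * u * (η * u) ^ 2 := by gcongr
    _ = η ^ 2 * c * u ^ 3 := by ring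

lemma abs_sinKernel_le_inv (c η : ℝ) {u : ℝ} (hu : 0 < u) :
    |sinKernel c η u| ≤ η ^ 2 * u⁻¹ := by
  unfold sinKernel
  rw [abs_div, abs_mul, abs_pow, abs_pow, abs_of_pos hu, div_le_iff₀ (by positivity)]
  have h2 : |Real.sin (η * u)| ^ 2 ≤ (η * u) ^ 2 := by
    rw [sq_abs]
    exact sq_le_sq.2 Real.abs_sin_le_abs
  calc |Real.sin (c * u)| * |Real.sin (η * u)| ^ 2 ≤ 1 * (η * u) ^ 2 := by
        gcongr
        exact Real.abs_sin_le_one _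
    _ = η ^ 2 * u⁻¹ * u ^ 3 := by field_simp

lemma abs_sinKernel_le_inv_cube (c η : ℝ) {u : ℝ} (hu : 0 < u) :
    |sinKernel c η u| ≤ (u ^ 3)⁻¹ := by
  unfold sinKernel
  rw [abs_div, abs_mul, abs_pow, abs_pow, abs_of_pos hu, div_eq_mul_inv]
  refine mul_le_of_le_one_left (by positivity) (mul_le_one₀ (Real.abs_sin_le_one _)
    (by positivity) (pow_le_one₀ (abs_nonneg _) (Real.abs_sin_le_one _)))

lemma abs_sinKernel_abs (c η u : ℝ) : |sinKernel c η (|u|)| = |sinKernel c η u| := by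
  rcases abs_choice u with h | h <;> rw [h]
  rw [sinKernel_neg]

/-- The kernel has `L¹` norm of logarithmic size in `c / η`. -/
lemma integral_abs_sinKernel_le {c η : ℝ} (hη : 0 < η) (hηc : η ≤ c) :
    ∫ u, |sinKernel c η u| ≤ η ^ 2 * (3 + 2 * Real.log (c / η)) := by
  have hc : 0 < c := hη.trans_le hηc
  have hint : Integrable fun u => |sinKernel c η u| := (integrable_sinKernel c η).abs
  have hle : c⁻¹ ≤ η⁻¹ := inv_anti₀ hη hηc
  have hc' : 0 < c⁻¹ := inv_pos.2 hc
  have hη' : 0 < η⁻¹ := inv_pos.2 hη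
  -- The bounds `η² c`, `η² / u` and `1 / u³` cross at `1 / c` and `1 / η`. Only the middle range
  -- produces a logarithm.
  have h1 : ∫ u in (0 : ℝ)..c⁻¹, |sinKernel c η u| ≤ η ^ 2 := by
    calc ∫ u in (0 : ℝ)..c⁻¹, |sinKernel c η u| ≤ ∫ u in (0 : ℝ)..c⁻¹, η ^ 2 * c := by
          refine intervalIntegral.integral_mono_on_of_le_Ioo hc'.le hint.intervalIntegrable
            intervalIntegrable_const fun u hu => abs_sinKernel_le_mul c η hc.le hu.1
      _ = η ^ 2 := by
          rw [intervalIntegral.integral_const, smul_eq_mul]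
          field_simp
          ring
  have h2 : ∫ u in c⁻¹..η⁻¹, |sinKernel c η u| ≤ η ^ 2 * Real.log (c / η) := by
    calc ∫ u in c⁻¹..η⁻¹, |sinKernel c η u| ≤ ∫ u in c⁻¹..η⁻¹, η ^ 2 * u⁻¹ := by
          refine intervalIntegral.integral_mono_on_of_le_Ioo hle hint.intervalIntegrable
            ?_ fun u hu => abs_sinKernel_le_inv c η (hc'.trans hu.1)
          refine (intervalIntegral.intervalIntegrable_inv (fun u hu => ?_)
            continuousOn_id).const_mul _
          rw [uIcc_of_le hle] at hu
          exact (hc'.trans_le hu.1).ne'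
      _ = η ^ 2 * Real.log (c / η) := by
          rw [intervalIntegral.integral_const_mul, integral_inv_of_pos hc' hη']
          congr 2
          field_simp
  have h3 : ∫ u in Ioi η⁻¹, |sinKernel c η u| ≤ η ^ 2 / 2 := by
    calc ∫ u in Ioi η⁻¹, |sinKernel c η u| ≤ ∫ u in Ioi η⁻¹, u ^ (-3 : ℝ) := by
          refine setIntegral_mono_on hint.integrableOn
            (integrableOn_Ioi_rpow_of_lt (by norm_num) hη') measurableSet_Ioi fun u hu => ?_
          have hu' : 0 < u := hη'.trans hu
          refine (abs_sinKernel_le_inv_cube c η hu').trans_eq ?_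
          rw [Real.rpow_neg hu'.le]
          norm_cast
      _ = η ^ 2 / 2 := by
          rw [integral_Ioi_rpow_of_lt (by norm_num) hη',
            show (-3 + 1 : ℝ) = -(2 : ℕ) by norm_num, Real.rpow_neg hη'.le, Real.rpow_natCast]
          simp
  have hsplit : ∫ u, |sinKernel c η u| = 2 * ∫ u in Ioi (0 : ℝ), |sinKernel c η u| := by
    rw [← integral_comp_abs (f := fun u => |sinKernel c η u|)]
    simp_rw [abs_sinKernel_abs]
  rw [hsplit, ← intervalIntegral.integral_interval_add_Ioi hint.integrableOn
      hint.integrableOn (b := η⁻¹), ← intervalIntegral.integral_add_adjacent_intervals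
      hint.intervalIntegrable hint.intervalIntegrable (b := c⁻¹)]
  linarith

/-! ### Abel summation and the half plane of convergence -/

/-- Both differences are integrals over `[x, y]` of derivatives whose norms compare pointwise. The
right side telescopes along a monotone sequence. -/
lemma norm_exp_neg_mul_sub_le {x y : ℝ} (hxy : x ≤ y) {w : ℂ} (hw : 0 < w.re) :
    ‖Complex.exp (-(x : ℂ) * w) - Complex.exp (-(y : ℂ) * w)‖ ≤
      ‖w‖ / w.re * (Real.exp (-x * w.re) - Real.exp (-y * w.re)) := by
  have h1 : ∀ t : ℝ, HasDerivAt (fun t : ℝ => -Complex.exp (-(t : ℂ) * w))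
      (w * Complex.exp (-(t : ℂ) * w)) t := by
    intro t
    have := ((Complex.ofRealCLM.hasDerivAt (x := t)).neg.mul_const w).cexp.neg
    exact this.congr_deriv (by simp [mul_comm])
  have h2 : ∀ t : ℝ, HasDerivAt (fun t : ℝ => -(‖w‖ / w.re * Real.exp (-t * w.re)))
      (‖w‖ * Real.exp (-t * w.re)) t := by
    intro t
    have := (((hasDerivAt_id t).neg.mul_const w.re).exp.const_mul (‖w‖ / w.re)).neg
    exact this.congr_deriv (by simp; field_simp)
  have e1 := intervalIntegral.integral_eq_sub_of_hasDerivAt (a := x) (b := y)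
    (fun t _ => h1 t) (Continuous.intervalIntegrable (by fun_prop) _ _)
  have e2 := intervalIntegral.integral_eq_sub_of_hasDerivAt (a := x) (b := y)
    (fun t _ => h2 t) (Continuous.intervalIntegrable (by fun_prop) _ _)
  have hle := intervalIntegral.norm_integral_le_of_norm_le (μ := volume)
    (f := fun t : ℝ => w * Complex.exp (-(t : ℂ) * w))
    (g := fun t : ℝ => ‖w‖ * Real.exp (-t * w.re)) hxy
    (ae_of_all _ fun t _ => by
      rw [norm_mul, Complex.norm_exp]
      simp) (Continuous.intervalIntegrable (by fun_prop) _ _)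
  rw [e1, e2] at hle
  calc _ = ‖-Complex.exp (-(y : ℂ) * w) - -Complex.exp (-(x : ℂ) * w)‖ := by congr 1; ring
    _ ≤ _ := hle
    _ = _ := by ring

lemma norm_exp_neg_mul_le_one {x : ℝ} (hx : 0 ≤ x) {w : ℂ} (hw : 0 ≤ w.re) :
    ‖Complex.exp (-(x : ℂ) * w)‖ ≤ 1 := by
  rw [Complex.norm_exp]
  simpa using mul_nonneg hx hw

/-- Abel's estimate for Dirichlet polynomials with bounded coefficient sums. -/
lemma norm_sum_mul_exp_le {μ : ℕ → ℝ} (hμ : Monotone μ) (hμ0 : ∀ n, 0 ≤ μ n) {b : ℕ → ℂ} {R : ℝ}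
    (hb : ∀ M, ‖∑ n ∈ Finset.range M, b n‖ ≤ R) {w : ℂ} (hw : 0 < w.re) (M : ℕ) :
    ‖∑ n ∈ Finset.range M, b n * Complex.exp (-(μ n : ℂ) * w)‖ ≤ R * (1 + ‖w‖ / w.re) := by
  have hR : 0 ≤ R := (norm_nonneg _).trans (hb 0)
  have h := Finset.sum_range_by_parts (fun n => Complex.exp (-(μ n : ℂ) * w)) b M
  simp only [smul_eq_mul] at h
  rw [Finset.sum_congr rfl fun n _ => mul_comm (b n) _, h]
  refine (norm_sub_le _ _).trans ?_
  rw [mul_add, mul_one]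
  gcongr
  · rw [norm_mul]
    exact (mul_le_of_le_one_left (norm_nonneg _)
      (norm_exp_neg_mul_le_one (hμ0 _) hw.le)).trans (hb M)
  · calc _ ≤ ∑ i ∈ Finset.range (M - 1), R * (‖w‖ / w.re) *
            (Real.exp (-μ i * w.re) - Real.exp (-μ (i + 1) * w.re)) := by
          refine norm_sum_le_of_le _ fun i _ => ?_
          rw [norm_mul, norm_sub_rev, mul_comm, mul_assoc]
          gcongr
          · exact hb _
          · exact norm_exp_neg_mul_sub_le (hμ (Nat.le_succ i)) hw
      _ = R * (‖w‖ / w.re) * (Real.exp (-μ 0 * w.re) - Real.exp (-μ (M - 1) * w.re)) := by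
          rw [← Finset.mul_sum, Finset.sum_range_sub' (fun i => Real.exp (-μ i * w.re))]
      _ ≤ R * (‖w‖ / w.re) * 1 := by
          gcongr
          have h1 : Real.exp (-μ 0 * w.re) ≤ 1 :=
            Real.exp_le_one_iff.2 (by nlinarith [mul_nonneg (hμ0 0) hw.le])
          linarith [Real.exp_pos (-μ (M - 1) * w.re)]
      _ = _ := mul_one _

lemma partialSum_eq_sum_mul_exp_sub (lam : ℕ → ℝ) (a : ℕ → ℂ) (N : ℕ) (s₁ s : ℂ) :
    partialSum lam a N s = ∑ n ∈ Finset.range N,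
      a n * Complex.exp (-(lam n : ℂ) * s₁) * Complex.exp (-(lam n : ℂ) * (s - s₁)) := by
  refine Finset.sum_congr rfl fun n _ => ?_
  rw [mul_assoc, ← Complex.exp_add]
  ring_nf

variable {lam : ℕ → ℝ} {a : ℕ → ℂ}

/-- On a vertical line this is linear growth in `Im s`, uniform in `M`, which supplies the
dominating function for the limit `M → ∞`. -/
lemma ConvergesAt.exists_norm_partialSum_le (hlam : IsFrequency lam) {s₁ : ℂ}
    (h : ConvergesAt lam a s₁) : ∃ R : ℝ, 0 ≤ R ∧ ∀ s : ℂ, s₁.re < s.re → ∀ M,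
      ‖partialSum lam a M s‖ ≤ R * (1 + ‖s - s₁‖ / (s - s₁).re) := by
  obtain ⟨l, hl⟩ := h
  obtain ⟨R, hR⟩ := hl.norm.bddAbove_range
  have hb : ∀ M, ‖partialSum lam a M s₁‖ ≤ R := fun M => hR ⟨M, rfl⟩
  refine ⟨R, (norm_nonneg _).trans (hb 0), fun s hs M => ?_⟩
  rw [partialSum_eq_sum_mul_exp_sub lam a M s₁ s]
  exact norm_sum_mul_exp_le hlam.strictMono.monotone hlam.nonneg hb (by simpa using hs) M

lemma ConvergesAt.of_re_lt (hlam : IsFrequency lam) {s₁ s : ℂ} (h : ConvergesAt lam a s₁)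
    (hs : s₁.re < s.re) : ConvergesAt lam a s := by
  obtain ⟨l, hl⟩ := h
  have hw : 0 < (s - s₁).re := by simpa using hs
  refine cauchySeq_tendsto_of_complete (Metric.cauchySeq_iff'.2 fun ε hε => ?_)
  set A : ℝ := 1 + ‖s - s₁‖ / (s - s₁).re with hA
  have hA0 : 0 < A := by positivity
  obtain ⟨K, hK⟩ := Metric.cauchySeq_iff'.1 hl.cauchySeq (ε / (2 * A)) (by positivity)
  refine ⟨K, fun n hn => ?_⟩
  obtain ⟨m, rfl⟩ := Nat.exists_eq_add_of_le hn
  have hb : ∀ M, ‖∑ n ∈ Finset.range M,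
      a (K + n) * Complex.exp (-(lam (K + n) : ℂ) * s₁)‖ ≤ ε / (2 * A) := by
    intro M
    have := (hK (K + M) (Nat.le_add_right _ _)).le
    rw [dist_eq_norm, partialSum, partialSum, Finset.sum_range_add_sub_sum_range] at this
    exact this
  have := norm_sum_mul_exp_le (μ := fun n => lam (K + n))
    (fun i j hij => hlam.strictMono.monotone (by omega)) (fun n => hlam.nonneg _) hb hw m
  rw [dist_eq_norm, partialSum_eq_sum_mul_exp_sub lam a _ s₁ s,
    partialSum_eq_sum_mul_exp_sub lam a K s₁ s, Finset.sum_range_add_sub_sum_range]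
  refine this.trans_lt ?_
  rw [← hA]
  field_simp
  linarith

lemma ConvergesAt.abscissaConv_le (hlam : IsFrequency lam) {s₁ : ℂ}
    (h : ConvergesAt lam a s₁) : abscissaConv lam a ≤ (s₁.re : EReal) :=
  sInf_le ⟨s₁.re, fun _ hs => h.of_re_lt hlam hs, rfl⟩

lemma continuous_partialSum (lam : ℕ → ℝ) (a : ℕ → ℂ) (N : ℕ) :
    Continuous (partialSum lam a N) := by
  unfold partialSum
  fun_prop

lemma differentiable_partialSum (lam : ℕ → ℝ) (a : ℕ → ℂ) (N : ℕ) :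
    Differentiable ℂ (partialSum lam a N) := by
  unfold partialSum
  fun_prop

lemma isOpen_halfPlane (σ : ℝ) : IsOpen (halfPlane σ) :=
  isOpen_lt continuous_const Complex.continuous_re

/-! ### Vertical averages of the extension -/

/-- Averaging a bounded holomorphic function along vertical lines keeps it holomorphic. -/
lemma differentiableOn_integral_vertical {f : ℂ → ℂ} (hf : DifferentiableOn ℂ f (halfPlane 0))
    {M : ℝ} (hM : ∀ s ∈ halfPlane 0, ‖f s‖ ≤ M) {k : ℝ → ℂ} (hk : Integrable k) :
    DifferentiableOn ℂ (fun s => ∫ u : ℝ, k u * f (s + u * Complex.I)) (halfPlane 0) := by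
  intro s₀ hs₀
  have hs₀' : 0 < s₀.re := hs₀
  have hline : ∀ {g : ℂ → ℂ} {s : ℂ}, ContinuousOn g (halfPlane 0) → s ∈ halfPlane 0 →
      Continuous fun u : ℝ => g (s + u * Complex.I) := by
    intro g s hg hs
    refine hg.comp_continuous (by fun_prop) fun u => ?_
    simpa [halfPlane] using hs
  have hder : ContinuousOn (deriv f) (halfPlane 0) :=
    (hf.deriv (isOpen_halfPlane 0)).continuousOn
  -- Discs of radius `r` about points with real part above `r` stay in `[Re > 0]`, so Cauchy's
  -- estimate gives `‖f'‖ ≤ M / r` along the whole line.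
  set r : ℝ := s₀.re / 2 with hr
  have hr0 : 0 < r := by positivity
  have hball : ∀ x ∈ Metric.ball s₀ r, r < x.re := by
    intro x hx
    have h1 := (Complex.abs_re_le_norm (x - s₀)).trans_lt (mem_ball_iff_norm.1 hx)
    rw [Complex.sub_re] at h1
    have := (abs_lt.1 h1).1
    linarith
  refine ((hasDerivAt_integral_of_dominated_loc_of_deriv_le (μ := volume)
    (F := fun s (u : ℝ) => k u * f (s + u * Complex.I))
    (F' := fun s (u : ℝ) => k u * deriv f (s + u * Complex.I))
    (bound := fun u => ‖k u‖ * (M / r)) (Metric.ball_mem_nhds s₀ hr0) ?_ ?_ ?_ ?_ ?_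
    ?_).2.differentiableAt).differentiableWithinAt
  · filter_upwards [(isOpen_halfPlane 0).mem_nhds hs₀] with s hs
    exact hk.aestronglyMeasurable.mul (hline hf.continuousOn hs).aestronglyMeasurable
  · refine hk.mul_bdd (c := M) (hline hf.continuousOn hs₀).aestronglyMeasurable
      (ae_of_all _ fun u => hM _ ?_)
    simpa [halfPlane] using hs₀
  · exact hk.aestronglyMeasurable.mul (hline hder hs₀).aestronglyMeasurable
  · refine ae_of_all _ fun u x hx => ?_
    rw [norm_mul]
    gcongr
    have hsub : Metric.closedBall (x + u * Complex.I) r ⊆ halfPlane 0 := by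
      intro z hz
      have h1 := (Complex.abs_re_le_norm (z - (x + u * Complex.I))).trans
        (mem_closedBall_iff_norm.1 hz)
      simp only [Complex.sub_re, Complex.add_re, Complex.re_ofReal_mul, Complex.I_re,
        mul_zero, add_zero] at h1
      have := (abs_le.1 h1).1
      have := hball x hx
      change 0 < z.re
      linarith
    refine Complex.norm_deriv_le_of_forall_mem_sphere_norm_le hr0 ?_
      fun z hz => hM z (hsub (Metric.sphere_subset_closedBall hz))
    refine DifferentiableOn.diffContOnCl (hf.mono ?_)
    exact Metric.closure_ball_subset_closedBall.trans hsub
  · exact hk.norm.mul_const _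
  · refine ae_of_all _ fun u x hx => ?_
    have hx' : x + u * Complex.I ∈ halfPlane 0 := by
      have := hball x hx
      simp only [halfPlane, mem_ofPred_eq, Complex.add_re, Complex.re_ofReal_mul, Complex.I_re,
        mul_zero, add_zero]
      linarith
    have h1 := ((hf.differentiableAt ((isOpen_halfPlane 0).mem_nhds hx')).hasDerivAt)
    exact (h1.comp_add_const x (u * Complex.I)).const_mul (k u)

/-- The cubic decay leaves room for one factor `|u|`, matching the linear growth of the partial sums
on vertical lines. -/
lemma abs_mul_abs_sinKernel_le {c : ℝ} (hc : 0 ≤ c) (η u : ℝ) :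
    |u| * |sinKernel c η u| ≤ 2 * (1 + η ^ 2 * c) * (1 + u ^ 2)⁻¹ := by
  rcases eq_or_ne u 0 with rfl | hu
  · simp only [abs_zero, zero_mul]
    positivity
  have hu' : 0 < |u| := abs_pos.2 hu
  rw [← abs_sinKernel_abs, ← sq_abs u, ← div_eq_mul_inv, le_div_iff₀ (by positivity)]
  generalize |u| = v at hu'
  have hηc : 0 ≤ η ^ 2 * c := by positivity
  rcases le_total v 1 with h1 | h1
  · have h2 : 1 + v ^ 2 ≤ 2 := by nlinarith
    calc v * |sinKernel c η v| * (1 + v ^ 2) ≤ 1 * (η ^ 2 * c) * 2 := by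
          gcongr
          exact abs_sinKernel_le_mul c η hc hu'
      _ ≤ _ := by linarith
  · have h2 : 1 + v ^ 2 ≤ 2 * v ^ 2 := by nlinarith
    calc v * |sinKernel c η v| * (1 + v ^ 2) ≤ v * (v ^ 3)⁻¹ * (2 * v ^ 2) := by
          gcongr
          exact abs_sinKernel_le_inv_cube c η hu'
      _ = 2 := by field_simp
      _ ≤ _ := by linarith

lemma integrable_abs_mul_sinKernel {c : ℝ} (hc : 0 ≤ c) (η : ℝ) :
    Integrable fun u : ℝ => |u| * |sinKernel c η u| := by
  refine (integrable_inv_one_add_sq.const_mul (2 * (1 + η ^ 2 * c))).mono' ?_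
    (ae_of_all _ fun u => ?_)
  · exact ((measurable_id.abs).mul (measurable_sinKernel c η).abs).aestronglyMeasurable
  · rw [Real.norm_of_nonneg (by positivity)]
    exact abs_mul_abs_sinKernel_le hc η u

lemma partialSum_add_mul_I (lam : ℕ → ℝ) (a : ℕ → ℂ) (N : ℕ) (s : ℂ) (u : ℝ) :
    partialSum lam a N (s + u * Complex.I) = ∑ n ∈ Finset.range N,
      a n * Complex.exp (-(lam n : ℂ) * s) * Complex.exp (-(lam n : ℂ) * (u * Complex.I)) := by
  refine Finset.sum_congr rfl fun n _ => ?_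
  rw [mul_assoc, ← Complex.exp_add]
  ring_nf

/-- Smoothing a long partial sum along a vertical line with the kernel cuts it off. -/
lemma integral_sinKernel_mul_partialSum (hlam : IsFrequency lam) {c η : ℝ} (hη : 0 ≤ η) {N : ℕ}
    (hN : lam N ≤ c - 2 * η) (hN' : c + 2 * η ≤ lam (N + 1)) (s : ℂ) {M : ℕ} (hM : N + 1 ≤ M) :
    ∫ u : ℝ, (sinKernel c η u : ℂ) * partialSum lam a M (s + u * Complex.I) =
      ((2 * sinRemainderIntegral * η ^ 2 : ℝ) : ℂ) * partialSum lam a (N + 1) s := by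
  have hint : ∀ n, Integrable fun u : ℝ => a n * Complex.exp (-(lam n : ℂ) * s) *
      ((sinKernel c η u : ℂ) * Complex.exp (-(lam n : ℂ) * (u * Complex.I))) := by
    intro n
    refine ((integrable_sinKernel c η).ofReal.mul_bdd (c := 1) ?_
      (ae_of_all _ fun u => ?_)).const_mul _
    · exact Continuous.aestronglyMeasurable (by fun_prop)
    · exact norm_exp_neg_mul_le_one (hlam.nonneg n) (by simp)
  have hsum : ∀ u : ℝ, (sinKernel c η u : ℂ) * partialSum lam a M (s + u * Complex.I) =
      ∑ n ∈ Finset.range M, a n * Complex.exp (-(lam n : ℂ) * s) *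
        ((sinKernel c η u : ℂ) * Complex.exp (-(lam n : ℂ) * (u * Complex.I))) := by
    intro u
    rw [partialSum_add_mul_I, Finset.mul_sum]
    exact Finset.sum_congr rfl fun n _ => by ring
  simp_rw [hsum]
  rw [integral_finsetSum _ fun n _ => hint n]
  simp_rw [integral_const_mul, integral_sinKernel_mul_cexp]
  rw [partialSum, Finset.mul_sum]
  symm
  refine (Finset.sum_subset_zero_on_sdiff (Finset.range_subset_range.2 hM) (fun n hn => ?_)
    fun n hn => ?_)
  · have hn' : N + 1 ≤ n := by simpa using (Finset.mem_sdiff.1 hn).2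
    rw [integral_sinKernel_mul_cos_of_ge hη (by linarith [hlam.nonneg N])
      (hN'.trans (hlam.strictMono.monotone hn'))]
    simp
  · have hn' : n ≤ N := Nat.lt_succ_iff.1 (Finset.mem_range.1 hn)
    rw [integral_sinKernel_mul_cos_of_le hη (hlam.nonneg n)
      ((hlam.strictMono.monotone hn').trans hN), mul_comm]

/-- To the right of `s₁` the partial sums converge to `f` with a linearly growing bound. Dominated
convergence applies, and the averages are constant in `M` once `M ≥ N + 1`. -/
lemma integral_sinKernel_mul_extension_of_re_gt (hlam : IsFrequency lam) {s₁ : ℂ}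
    (hconv : ConvergesAt lam a s₁) {f : ℂ → ℂ} (hf : IsBoundedExtension lam a f) {c η : ℝ}
    (hη : 0 ≤ η) {N : ℕ} (hN : lam N ≤ c - 2 * η) (hN' : c + 2 * η ≤ lam (N + 1)) {s : ℂ}
    (hs : 0 < s.re) (hs₁ : s₁.re < s.re) :
    ∫ u : ℝ, (sinKernel c η u : ℂ) * f (s + u * Complex.I) =
      ((2 * sinRemainderIntegral * η ^ 2 : ℝ) : ℂ) * partialSum lam a (N + 1) s := by
  have hc : 0 ≤ c := by linarith [hlam.nonneg N]
  obtain ⟨R, hR0, hR⟩ := hconv.exists_norm_partialSum_le hlam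
  have hd : 0 < (s - s₁).re := by simpa using hs₁
  have hlim : Tendsto (fun M => ∫ u : ℝ, (sinKernel c η u : ℂ) *
      partialSum lam a M (s + u * Complex.I)) atTop
      (𝓝 (∫ u : ℝ, (sinKernel c η u : ℂ) * f (s + u * Complex.I))) := by
    refine tendsto_integral_of_dominated_convergence
      (fun u => R * (1 + ‖s - s₁‖ / (s - s₁).re) * |sinKernel c η u| +
        R / (s - s₁).re * (|u| * |sinKernel c η u|)) (fun M => ?_) ?_ (fun M => ?_) ?_
    · exact (Complex.measurable_ofReal.comp (measurable_sinKernel c η)).aestronglyMeasurable.mul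
        ((continuous_partialSum lam a M).comp (by fun_prop)).aestronglyMeasurable
    · exact ((integrable_sinKernel c η).abs.const_mul _).add
        ((integrable_abs_mul_sinKernel hc η).const_mul _)
    · refine ae_of_all _ fun u => ?_
      have h1 := hR (s + u * Complex.I) (by simpa using hs₁) M
      have h2 : (s + u * Complex.I - s₁).re = (s - s₁).re := by simp
      have h3 : ‖s + u * Complex.I - s₁‖ ≤ ‖s - s₁‖ + |u| := by
        rw [add_sub_right_comm]
        exact (norm_add_le _ _).trans_eq (by simp)
      rw [h2] at h1
      rw [norm_mul, Complex.norm_real, Real.norm_eq_abs]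
      calc |sinKernel c η u| * ‖partialSum lam a M (s + u * Complex.I)‖
          ≤ |sinKernel c η u| * (R * (1 + (‖s - s₁‖ + |u|) / (s - s₁).re)) := by
            gcongr
            exact h1.trans (by gcongr)
        _ = _ := by ring
    · refine ae_of_all _ fun u => (hf.extends_series _ ?_ ?_).const_mul _
      · simpa [halfPlane] using hs
      · refine (hconv.abscissaConv_le hlam).trans_lt (EReal.coe_lt_coe_iff.2 ?_)
        simpa using hs₁
  refine tendsto_nhds_unique hlim (tendsto_const_nhds.congr' ?_)
  filter_upwards [eventually_ge_atTop (N + 1)] with M hM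
  rw [integral_sinKernel_mul_partialSum hlam hη hN hN' s hM]

/-- A partial sum of the series is a vertical average of the bounded extension. -/
lemma integral_sinKernel_mul_extension (hlam : IsFrequency lam) {s₁ : ℂ}
    (hconv : ConvergesAt lam a s₁) {f : ℂ → ℂ} (hf : IsBoundedExtension lam a f) {c η : ℝ}
    (hη : 0 ≤ η) {N : ℕ} (hN : lam N ≤ c - 2 * η) (hN' : c + 2 * η ≤ lam (N + 1)) {s : ℂ}
    (hs : s ∈ halfPlane 0) :
    ∫ u : ℝ, (sinKernel c η u : ℂ) * f (s + u * Complex.I) =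
      ((2 * sinRemainderIntegral * η ^ 2 : ℝ) : ℂ) * partialSum lam a (N + 1) s := by
  obtain ⟨M, hM⟩ := hf.bounded
  have h1 := (differentiableOn_integral_vertical hf.holomorphic hM
    (integrable_sinKernel c η).ofReal).analyticOnNhd (isOpen_halfPlane 0)
  have h2 := ((differentiable_partialSum lam a (N + 1)).const_mul
    ((2 * sinRemainderIntegral * η ^ 2 : ℝ) : ℂ)).differentiableOn.analyticOnNhd
    (isOpen_halfPlane 0)
  have hpre : IsPreconnected (halfPlane 0) := (convex_halfSpace_re_gt 0).isPreconnected
  set σ : ℝ := max s₁.re 0 with hσ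
  have hσ0 : 0 ≤ σ := le_max_right _ _
  -- Both sides are analytic on the connected half plane and agree near `σ + 1`, where the series
  -- converges.
  refine h1.eqOn_of_preconnected_of_eventuallyEq h2 hpre (z₀ := ((σ + 1 : ℝ) : ℂ)) ?_ ?_ hs
  · change 0 < ((σ + 1 : ℝ) : ℂ).re
    rw [Complex.ofReal_re]
    linarith
  · filter_upwards [(isOpen_halfPlane σ).mem_nhds
      (show ((σ + 1 : ℝ) : ℂ) ∈ halfPlane σ by simp [halfPlane])] with z hz
    exact integral_sinKernel_mul_extension_of_re_gt hlam hconv hf hη hN hN'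
      ((le_max_right _ _).trans_lt hz) ((le_max_left _ _).trans_lt hz)

/-! ### Growth of the partial sums under Landau's condition -/

/-- The factor `η²` of the kernel's norm cancels against the plateau height, so the gap enters only
through a logarithm. -/
lemma norm_partialSum_le_log (hlam : IsFrequency lam) {s₁ : ℂ} (hconv : ConvergesAt lam a s₁)
    {f : ℂ → ℂ} (hf : IsBoundedExtension lam a f) {M : ℝ} (hM : ∀ s ∈ halfPlane 0, ‖f s‖ ≤ M)
    {c η : ℝ} (hη : 0 < η) {N : ℕ} (hN : lam N ≤ c - 2 * η) (hN' : c + 2 * η ≤ lam (N + 1))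
    {s : ℂ} (hs : s ∈ halfPlane 0) :
    ‖partialSum lam a (N + 1) s‖ ≤
      (3 + 2 * Real.log (c / η)) / (2 * sinRemainderIntegral) * M := by
  have hB := sinRemainderIntegral_pos
  have hM0 : 0 ≤ M := (norm_nonneg _).trans (hM s hs)
  have h1 := integral_sinKernel_mul_extension hlam hconv hf hη.le hN hN' hs
  have h2 : ‖∫ u : ℝ, (sinKernel c η u : ℂ) * f (s + u * Complex.I)‖ ≤
      η ^ 2 * (3 + 2 * Real.log (c / η)) * M := by
    calc _ ≤ ∫ u : ℝ, |sinKernel c η u| * M := by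
          refine norm_integral_le_of_norm_le ((integrable_sinKernel c η).abs.mul_const M)
            (ae_of_all _ fun u => ?_)
          rw [norm_mul, Complex.norm_real, Real.norm_eq_abs]
          gcongr
          refine hM _ ?_
          simpa [halfPlane] using hs
      _ = (∫ u : ℝ, |sinKernel c η u|) * M := integral_mul_const _ _
      _ ≤ _ := by
          gcongr
          exact integral_abs_sinKernel_le hη (by linarith [hlam.nonneg N])
  rw [h1, norm_mul, Complex.norm_real, Real.norm_of_nonneg (by positivity)] at h2
  rw [div_mul_eq_mul_div, le_div_iff₀ (by positivity)]
  refine le_of_mul_le_mul_left ?_ (pow_pos hη 2)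
  linarith

/-- Under Landau's condition the logarithm of the relative gap grows at most like `exp (δ λ_N)`. -/
lemma LandauCondition.exists_cutoff (hlam : IsFrequency lam) (hLC : LandauCondition lam) {δ : ℝ}
    (hδ : 0 < δ) : ∃ A : ℝ, 0 ≤ A ∧ ∀ N, ∃ c η : ℝ, 0 < η ∧ lam N ≤ c - 2 * η ∧
      c + 2 * η ≤ lam (N + 1) ∧ Real.log (c / η) ≤ A * Real.exp (δ * lam N) := by
  obtain ⟨C, hC, hgap⟩ := hLC δ hδ
  set C' : ℝ := min C 1 with hC'
  have hC'0 : 0 < C' := lt_min hC one_pos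
  have hlogC : Real.log C' ≤ 0 := Real.log_nonpos hC'0.le (min_le_right _ _)
  -- The terms `4 / δ` and `2` absorb the numerator `4 λ_N + 2`, `1` is the double exponential of
  -- Landau's condition, and `-log C'` is its constant.
  refine ⟨4 / δ + 2 + 1 - Real.log C', by linarith [show 0 < 4 / δ by positivity], fun N => ?_⟩
  have hl := hlam.nonneg N
  -- Capping the gap at 1 keeps `c` within `1 / 2` of `λ_N`, however far away `λ_{N+1}` is.
  set g : ℝ := min (lam (N + 1) - lam N) 1 with hg
  have hgle : g ≤ lam (N + 1) - lam N := min_le_left _ _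
  have hg1 : g ≤ 1 := min_le_right _ _
  have hglow : C' * Real.exp (-Real.exp (δ * lam N)) ≤ g := by
    refine le_min ((mul_le_mul_of_nonneg_right (min_le_left _ _) (Real.exp_pos _).le).trans
      (hgap N)) (mul_le_one₀ (min_le_right _ _) (Real.exp_pos _).le ?_)
    exact Real.exp_le_one_iff.2 (neg_nonpos.2 (Real.exp_pos _).le)
  have hg0 : 0 < g := lt_of_lt_of_le (by positivity) hglow
  -- The cutoff falls exactly over `[λ_N, λ_N + g]`.
  refine ⟨lam N + g / 2, g / 4, by positivity, by linarith, by linarith, ?_⟩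
  have hlogg : Real.log C' - Real.exp (δ * lam N) ≤ Real.log g := by
    calc _ = Real.log (C' * Real.exp (-Real.exp (δ * lam N))) := by
          rw [Real.log_mul hC'0.ne' (Real.exp_pos _).ne', Real.log_exp]
          ring
      _ ≤ _ := Real.log_le_log (by positivity) hglow
  have hnum : Real.log (4 * lam N + 2 * g) ≤ 4 * lam N + 2 := by
    refine (Real.log_le_sub_one_of_pos (by positivity)).trans ?_
    linarith
  have hE : 1 ≤ Real.exp (δ * lam N) := Real.one_le_exp (by positivity)
  have hlin : 4 * lam N ≤ 4 / δ * Real.exp (δ * lam N) := by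
    rw [div_mul_eq_mul_div, le_div_iff₀ hδ]
    linarith [Real.add_one_le_exp (δ * lam N)]
  rw [show (lam N + g / 2) / (g / 4) = (4 * lam N + 2 * g) / g by field_simp; ring,
    Real.log_div (by positivity) hg0.ne']
  have h3 : -Real.log C' ≤ -Real.log C' * Real.exp (δ * lam N) :=
    le_mul_of_one_le_right (by linarith) hE
  linarith

lemma exists_norm_partialSum_le (hlam : IsFrequency lam) (hLC : LandauCondition lam) {δ : ℝ}
    (hδ : 0 < δ) : ∃ C : ℝ, 0 < C ∧ ∀ a ∈ DInftyExt lam, ∀ f : ℂ → ℂ,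
      IsBoundedExtension lam a f → ∀ M : ℝ, (∀ s ∈ halfPlane 0, ‖f s‖ ≤ M) →
        ∀ N : ℕ, ∀ s ∈ halfPlane 0,
          ‖partialSum lam a (N + 1) s‖ ≤ C * Real.exp (δ * lam N) * M := by
  obtain ⟨A, hA, hcut⟩ := hLC.exists_cutoff hlam hδ
  have hB := sinRemainderIntegral_pos
  refine ⟨(3 + 2 * A) / (2 * sinRemainderIntegral), by positivity, ?_⟩
  rintro a ⟨⟨s₁, hs₁⟩, -⟩ f hf M hM N s hs
  obtain ⟨c, η, hη, hN, hN', hlog⟩ := hcut N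
  have hM0 : 0 ≤ M := (norm_nonneg _).trans (hM s hs)
  have hE : 1 ≤ Real.exp (δ * lam N) := Real.one_le_exp (mul_nonneg hδ.le (hlam.nonneg N))
  refine (norm_partialSum_le_log hlam hs₁ hf hM hη hN hN' hs).trans ?_
  rw [div_mul_eq_mul_div (3 + 2 * A)]
  gcongr
  linarith

/-! ### Uniform convergence -/

/-- Uniform growth bounds on the partial sums over `[Re > 0]` give uniform convergence on the
smaller half planes. -/
lemma tendstoUniformlyOn_partialSum (hlam : IsFrequency lam) {δ K : ℝ} (hδ : 0 < δ)
    (hK : ∀ N : ℕ, ∀ s ∈ halfPlane 0,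
      ‖partialSum lam a (N + 1) s‖ ≤ K * Real.exp (δ * lam N)) :
    ∃ g : ℂ → ℂ, TendstoUniformlyOn (partialSum lam a) g atTop (halfPlane (2 * δ)) := by
  set x : ℕ → ℝ := fun n => Real.exp (-(δ * lam n)) with hx
  have hx0 : ∀ n, 0 < x n := fun n => Real.exp_pos _
  have hxanti : ∀ n, x (n + 1) ≤ x n := fun n => by
    refine Real.exp_le_exp.2 (neg_le_neg ?_)
    gcongr
    exact hlam.strictMono.monotone n.le_succ
  have hxlim : Tendsto x atTop (𝓝 0) :=
    Real.tendsto_exp_neg_atTop_nhds_zero.comp (hlam.tendsto_atTop.const_mul_atTop hδ)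
  have hxexp : ∀ n, Real.exp (δ * lam n) = (x n)⁻¹ := fun n => by
    rw [hx, ← Real.exp_neg, neg_neg]
  have hK0 : 0 ≤ K := by
    have := (norm_nonneg _).trans (hK 0 1 (by simp [halfPlane]))
    exact nonneg_of_mul_nonneg_left this (Real.exp_pos _)
  have hshift : ∀ s ∈ halfPlane (2 * δ), s - (2 * δ : ℝ) ∈ halfPlane 0 := fun s hs => by
    have hs' : 2 * δ < s.re := hs
    change 0 < (s - (2 * δ : ℝ)).re
    rw [Complex.sub_re, Complex.ofReal_re]
    linarith
  -- Summation by parts against `x n ^ 2 = e^{-2δ λ_n}`. The partial sums are at most `K / x n`, and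
  -- `x n ^ 2 - x (n + 1) ^ 2 ≤ 2 x n (x n - x (n + 1))`, so a telescoping majorant remains.
  set T : ℕ → ℂ → ℂ := fun n s =>
    ((x (n + 1) ^ 2 - x n ^ 2 : ℝ) : ℂ) * partialSum lam a (n + 1) (s - (2 * δ : ℝ)) with hT
  have hsum : Summable fun n => 2 * K * (x n - x (n + 1)) := by
    refine Summable.mul_left _ (summable_of_sum_range_le (c := x 0)
      (fun n => sub_nonneg.2 (hxanti n)) fun n => ?_)
    rw [Finset.sum_range_sub']
    linarith [hx0 n]
  have hTle : ∀ n s, s ∈ halfPlane (2 * δ) → ‖T n s‖ ≤ 2 * K * (x n - x (n + 1)) := by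
    intro n s hs
    have h1 := hK n _ (hshift s hs)
    rw [hxexp] at h1
    rw [hT, norm_mul, Complex.norm_real, Real.norm_eq_abs, abs_sub_comm,
      abs_of_nonneg (sub_nonneg.2 (pow_le_pow_left₀ (hx0 _).le (hxanti n) 2))]
    have h2 := hx0 n
    have h3 := hx0 (n + 1)
    have h4 := hxanti n
    calc (x n ^ 2 - x (n + 1) ^ 2) * ‖partialSum lam a (n + 1) (s - (2 * δ : ℝ))‖
        ≤ (x n - x (n + 1)) * (2 * x n) * (K * (x n)⁻¹) := by
          refine mul_le_mul ?_ h1 (norm_nonneg _)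
            (mul_nonneg (sub_nonneg.2 h4) (by positivity))
          nlinarith
      _ = 2 * K * (x n - x (n + 1)) := by field_simp
  have hparts : ∀ N s, partialSum lam a (N + 1) s =
      ((x N ^ 2 : ℝ) : ℂ) * partialSum lam a (N + 1) (s - (2 * δ : ℝ)) -
        ∑ n ∈ Finset.range N, T n s := by
    intro N s
    have hexp : ∀ n, Complex.exp (-(lam n : ℂ) * (2 * δ : ℝ)) = ((x n ^ 2 : ℝ) : ℂ) := by
      intro n
      rw [hx, ← Real.exp_nat_mul, Complex.ofReal_exp]
      push_cast
      ring_nf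
    have h := Finset.sum_range_by_parts (fun n => ((x n ^ 2 : ℝ) : ℂ))
      (fun n => a n * Complex.exp (-(lam n : ℂ) * (s - (2 * δ : ℝ)))) (N + 1)
    simp only [smul_eq_mul, Nat.add_sub_cancel, ← Complex.ofReal_sub] at h
    rw [hT]
    refine Eq.trans ?_ h
    refine Finset.sum_congr rfl fun n _ => ?_
    rw [← hexp, mul_left_comm, ← Complex.exp_add]
    ring_nf
  have hU := tendstoUniformlyOn_tsum_nat hsum hTle
  -- The boundary term is at most `K x n`, which tends to zero, so only the series of the `T n`
  -- survives.
  refine ⟨fun s => -∑' n, T n s, ?_⟩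
  rw [Metric.tendstoUniformlyOn_iff] at hU ⊢
  intro ε hε
  have hKx : ∀ᶠ n in atTop, K * x n < ε / 2 := by
    have := hxlim.const_mul K
    rw [mul_zero] at this
    exact this.eventually_lt_const (half_pos hε)
  rw [← map_add_atTop_eq_nat 1, eventually_map]
  filter_upwards [hU (ε / 2) (half_pos hε), hKx] with n hn hn' s hs
  have h1 := hK n _ (hshift s hs)
  rw [hxexp] at h1
  have h2 := hn s hs
  rw [dist_eq_norm] at h2 ⊢
  rw [hparts]
  have h3 : ‖((x n ^ 2 : ℝ) : ℂ) * partialSum lam a (n + 1) (s - (2 * δ : ℝ))‖ ≤ K * x n := by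
    rw [norm_mul, Complex.norm_real, Real.norm_of_nonneg (by positivity)]
    calc _ ≤ x n ^ 2 * (K * (x n)⁻¹) := by gcongr
      _ = K * x n := by
        have := (hx0 n).ne'
        field_simp
  calc _ = ‖-(∑' n, T n s - ∑ i ∈ Finset.range n, T i s) -
        ((x n ^ 2 : ℝ) : ℂ) * partialSum lam a (n + 1) (s - (2 * δ : ℝ))‖ := by
        congr 1; ring
    _ ≤ _ := norm_sub_le _ _
    _ < ε := by rw [norm_neg]; linarith

end GenDirichlet

theorem theorem4p2 (lam : ℕ → ℝ) (hlam : GenDirichlet.IsFrequency lam)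
    (hLC : GenDirichlet.LandauCondition lam) :
    (∀ δ : ℝ, 0 < δ → ∃ C : ℝ, 0 < C ∧
      ∀ a ∈ GenDirichlet.DInftyExt lam, ∀ f : ℂ → ℂ, GenDirichlet.IsBoundedExtension lam a f →
        ∀ N : ℕ,
          GenDirichlet.supRightHalfPlane (GenDirichlet.partialSum lam a (N + 1)) ≤
            ENNReal.ofReal (C * Real.exp (δ * lam N)) * GenDirichlet.supRightHalfPlane f) ∧
    GenDirichlet.SatisfiesBohr lam := by
  refine ⟨fun δ hδ => ?_, fun a ha ε hε => ?_⟩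
  · obtain ⟨C, hC, h⟩ := GenDirichlet.exists_norm_partialSum_le hlam hLC hδ
    refine ⟨C, hC, fun a ha f hf N => ?_⟩
    have hle : ∀ s ∈ GenDirichlet.halfPlane 0, ‖f s‖ₑ ≤ GenDirichlet.supRightHalfPlane f :=
      fun s hs => le_iSup₂ (f := fun s (_ : s ∈ GenDirichlet.halfPlane 0) => ‖f s‖ₑ) s hs
    -- Finiteness is needed because `toReal` would turn an infinite supremum into 0.
    have hfin : GenDirichlet.supRightHalfPlane f ≠ ⊤ := by
      obtain ⟨M, hM⟩ := hf.bounded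
      refine ne_top_of_le_ne_top (ENNReal.ofReal_ne_top (r := M)) (iSup₂_le fun s hs => ?_)
      rw [← ofReal_norm]
      exact ENNReal.ofReal_le_ofReal (hM s hs)
    refine iSup₂_le fun s hs => ?_
    have h1 := h a ha f hf (GenDirichlet.supRightHalfPlane f).toReal (fun z hz => by
      rw [← toReal_enorm]
      exact ENNReal.toReal_mono hfin (hle z hz)) N s hs
    rw [← ofReal_norm, ← ENNReal.ofReal_toReal hfin,
      ← ENNReal.ofReal_mul (by positivity)]
    exact ENNReal.ofReal_le_ofReal h1
  -- With `δ = ε / 2` the shift `2δ` is exactly `ε`.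
  · obtain ⟨C, hC, h⟩ := GenDirichlet.exists_norm_partialSum_le hlam hLC (half_pos hε)
    obtain ⟨f, hf⟩ := ha.2
    obtain ⟨M, hM⟩ := hf.bounded
    have := GenDirichlet.tendstoUniformlyOn_partialSum (K := C * M) hlam (half_pos hε)
      fun N s hs => (h a ha f hf M hM N s hs).trans_eq (by ring)
    rwa [mul_div_cancel₀ ε two_ne_zero] at this
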